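/- **Setting.** Let $\mathcal S$ be a set of sorts; simple types are built from sorts with $\to$. Let $\mathcal F$ (function symbols) and $\mathcal V$ (variables, infinitely many of each type) be sets of simply typed symbols; terms are the well-typed applicative terms over $\mathcal F\cup\mathcal V$, $\mathrm{Var}(t)$ is the set of variables of $t$, and substitutions are type-preserving maps from variables to terms. There are distinguished theory sorts (including $\mathsf{bool}$) and theory symbols (including true and false), every theory symbol having a type $A_1\to\cdots\to A_n\to B$ with all $A_i$ and $B$ theory sorts. Theory symbols are interpreted over sets $\mathfrak X_A$ ($A$ a theory sort; function types as full function spaces, $\mathfrak X_{\mathsf{bool}}=\{0,1\}$, true and false interpreted as $1$ and $0$), and $[\![\cdot]\!]$ is a bijection from the theory symbols of each theory sort $A$ (the *values*) to $\mathfrak X_A$; it extends to ground theory terms. A term $t$ is a (maximally applied) *subterm* of $s=a\,s_1\cdots s_n$ ($a$ a symbol or variable) if $t=s$ or $t$ is a subterm of some $s_i$; it is *proper* if $t\ne s$. A *logical constraint* is a theory term of type $\mathsf{bool}$ whose variables have theory sorts as types. A *rewrite rule* $\ell\to r\,[\varphi]$ consists of terms $\ell,r$ of the same type and a logical constraint $\varphi$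 such that variables in $\mathrm{Var}(r)\setminus\mathrm{Var}(\ell)$ have theory sorts as types, every subterm of $\ell$ is a variable or headed by a function symbol, $\ell=f\,t_1\cdots t_n$ for a function symbol $f$, and $\ell$ contains a non-theory symbol. A substitution $\sigma$ *respects* the rule if $\sigma(x)$ is a value for all $x\in\mathrm{Var}(\varphi)\cup(\mathrm{Var}(r)\setminus\mathrm{Var}(\ell))$ and $[\![\varphi\sigma]\!]=1$. A set $\mathcal R$ of rules (an LCSTRS) induces the relation $\to_{\mathcal R}$: the closure under contexts of the steps $\ell\sigma\to r\sigma$ with $\ell\to r\,[\varphi]\in\mathcal R$ and $\sigma$ respecting it, and of the calculation steps $f\,v_1\cdots v_n\to v'$ with $n>0$, $f$ a theory symbol, $v_i,v'$ values and $[\![f\,v_1\cdots v_n]\!]=[\![v']\!]$. A symbol is *defined* if it is the head of the left-hand side of a rule in $\mathcal R$. $\mathcal R$ is *terminating* if there is no infinite sequence $t_0\to_{\mathcal R}t_1\to_{\mathcal R}\cdots$. **Accessibility.** Let $\succsim$ be a sort ordering, i.e. a quasi-ordering on $\mathcal S$ with well-founded strict part $\succ$. For a sort $A$ and a type $B=B_1\to\cdots\to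 B_n\to C$ with $C$ a sort: $A\succsim_+B$ iff $A\succsim C$ and $A\succ_-B_i$ for all $i$; $A\succ_-B$ iff $A\succ C$ and $A\succsim_+B_i$ for all $i$. For $f:A_1\to\cdots\to A_n\to B$ with $B$ a sort, let $\mathrm{Acc}(f)=\{i\mid B\succsim_+A_i\}$. A term $t$ is an *accessible subterm* of $s$ if $s=t$, or $s=f\,s_1\cdots s_m$ and $t$ is an accessible subterm of $s_k$ for some $k\in\mathrm{Acc}(f)$ with $k\le m$. $\mathcal R$ is *accessible function passing* (AFP) with respect to $\succsim$ if for every rule $f\,s_1\cdots s_m\to r\,[\varphi]$ in $\mathcal R$, every $x\in(\mathrm{Var}(f\,s_1\cdots s_m)\cap\mathrm{Var}(r))\setminus\mathrm{Var}(\varphi)$ is an accessible subterm of some $s_k$. **Computability.** An *RC-set* for $\to_{\mathcal R}$ is a family $I=(I_A)_{A\in\mathcal S}$ of sets $I_A$ of terminating terms of type $A$, closed under $\to_{\mathcal R}$, and such that a term $x\,t_1\cdots t_n:A$ with $x$ a variable is in $I_A$ whenever all its one-step reducts are. A term $t$ of sort $A$ is *$I$-computable* if $t\in I_A$; a term $t:A\to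 B$ is $I$-computable if $t\,u$ is for every $I$-computable $u:A$. Write $s\Rrightarrow_It$ if $s$ and $t$ have base types, $s=f\,s_1\cdots s_m$ for a function symbol $f$, and $t=s_k\,t_1\cdots t_n$ for some $k\in\mathrm{Acc}(f)$ and $I$-computable $t_i$. A *computability predicate* for $(\mathcal R,\succsim)$ is an RC-set $\mathbb C$ such that, for each term $t$ of sort $A$, $t\in\mathbb C_A$ if and only if $t$ is terminating with respect to $\to_{\mathcal R}\cup\Rrightarrow_{\mathbb C}$ and, whenever $t\to_{\mathcal R}^*f\,t_1\cdots t_n$ with $f$ a function symbol, $t_i$ is $\mathbb C$-computable for every $i\in\mathrm{Acc}(f)$ with $i\le n$. **Static dependency pairs.** For each defined $f:A_1\to\cdots\to A_n\to B$ ($B$ a sort) let $f^\sharp:A_1\to\cdots\to A_n\to\mathsf{dp}$ be a fresh symbol, $\mathsf{dp}$ a fresh sort, and let $(f\,t_1\cdots t_k)^\sharp=f^\sharp\,t_1\cdots t_k$. The set $\mathrm{SDP}(\mathcal R)$ consists of all quadruples $$\ell^\sharp\,x_1\cdots x_m\Rightarrow g^\sharp\,t_1\cdots t_q\,y_{q+1}\cdots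 y_n\ [\varphi\mid L],\qquad L=\mathrm{Var}(\varphi)\cup(\mathrm{Var}(r)\setminus\mathrm{Var}(\ell)),$$ where $\ell\to r\,[\varphi]\in\mathcal R$, both sides have type $\mathsf{dp}$, $g\,t_1\cdots t_q$ is a subterm of $r\,x_1\cdots x_m$ with $g$ defined, and the $x_i,y_j$ are pairwise distinct variables not occurring in the rule. A substitution $\sigma$ *respects* such a quadruple if $\sigma(x)$ is a ground theory term for all $x\in L$ and $[\![\varphi\sigma]\!]=1$. An *infinite $(\mathrm{SDP}(\mathcal R),\mathcal R)$-chain* is a sequence $\big((s_i^\sharp\Rightarrow t_i^\sharp\,[\varphi_i\mid L_i]),\sigma_i\big)_{i\in\mathbb N}$ with each pair in $\mathrm{SDP}(\mathcal R)$, each $\sigma_i$ respecting the $i$-th pair, and $t_i^\sharp\sigma_i\to_{\mathcal R}^*s_{i+1}^\sharp\sigma_{i+1}$ for all $i$. It is *computable* (with respect to $\mathbb C$) if $u\sigma_i$ is $\mathbb C$-computable for all $i$ and all proper subterms $u$ of $t_i$. **Theorem.** Let $\mathcal R$ be an LCSTRS that is AFP with respect to a sort ordering $\succsim$. Then a computability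 predicate $\mathbb C$ for $(\mathcal R,\succsim)$ exists; and, for every such $\mathbb C$, if there is no infinite computable $(\mathrm{SDP}(\mathcal R),\mathcal R)$-chain, then $\mathcal R$ is terminating. -/

import Mathlib

universe u v w z

namespace LCSTRS

/-! ### Types and terms -/

/-- Simple types over a set `S` of sorts. -/
inductive Ty (S : Type u) : Type u
  | base : S → Ty S
  | arr : Ty S → Ty S → Ty S

namespace Ty

variable {S : Type u}

/-- The list `[A₁, …, Aₙ]` for the type `A₁ → ⋯ → Aₙ → B`, where `B` is a sort. -/
def args : Ty S → List (Ty S)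
  | base _ => []
  | arr A B => A :: B.args

/-- The sort `B` for the type `A₁ → ⋯ → Aₙ → B`. -/
def target : Ty S → S
  | base s => s
  | arr _ B => B.target

/-- The type is a sort satisfying `P`. -/
def IsSortIn (P : S → Prop) : Ty S → Prop
  | base s => P s
  | arr _ _ => False

/-- Theory types: `A₁ → ⋯ → Aₙ → B` where all `Aᵢ` and `B` are (theory) sorts satisfying `P`. -/
def IsTheory (P : S → Prop) : Ty S → Prop
  | base s => P s
  | arr A B => A.IsSortIn P ∧ B.IsTheory P

/-- The interpretation of types, with function types interpreted as full function spaces. -/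
def Den (X : S → Type z) : Ty S → Type z
  | base s => X s
  | arr A B => A.Den X → B.Den X

end Ty

/-- The data underlying a logically constrained system: sorts, typed function symbols, infinitely
many variables of each type, and an interpreted theory with booleans.  `F A` and `V A` are the sets
of function symbols and of variables of type `A`.  The sets `X s` are only ever used at theory
sorts `s`. -/
structure Signature where
  S : Type u
  F : Ty S → Type v
  V : Ty S → Type w
  infinite_vars : ∀ A, Infinite (V A)
  /-- the theory sorts -/
  theorySort : S → Prop
  /-- the theory symbols -/
  theorySym : ∀ {A : Ty S}, F A → Prop
  theorySym_type : ∀ {A : Ty S} (f : F A), theorySym f → A.IsTheory theorySort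
  X : S → Type z
  /-- the interpretation of the theory symbols -/
  interp : ∀ {A : Ty S} (f : F A), theorySym f → A.Den X
  interp_bijective : ∀ s : S, theorySort s →
    Function.Bijective (fun f : {f : F (Ty.base s) // theorySym f} => (interp f.1 f.2 : X s))
  bool : S
  bool_theory : theorySort bool
  /-- the identification of the interpretation of the sort `bool` with the truth values -/
  boolEquiv : X bool ≃ Bool
  ff : F (Ty.base bool)
  tt : F (Ty.base bool)
  ff_theory : theorySym ff
  tt_theory : theorySym tt
  interp_ff : boolEquiv (interp ff ff_theory) = false
  interp_tt : boolEquiv (interp tt tt_theory) = true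

/-- Simply typed applicative terms, indexed by their type. -/
inductive Term (Sg : Signature.{u, v, w, z}) : Ty Sg.S → Type (max u v w)
  | fn {A : Ty Sg.S} (f : Sg.F A) : Term Sg A
  | var {A : Ty Sg.S} (x : Sg.V A) : Term Sg A
  | app {A B : Ty Sg.S} (s : Term Sg (Ty.arr A B)) (t : Term Sg A) : Term Sg B

/-- A term together with its type. -/
abbrev Tm (Sg : Signature.{u, v, w, z}) := Σ A : Ty Sg.S, Term Sg A

/-- A function symbol together with its type. -/
abbrev Sym (Sg : Signature.{u, v, w, z}) := Σ A : Ty Sg.S, Sg.F A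

/-- A variable together with its type. -/
abbrev Var (Sg : Signature.{u, v, w, z}) := Σ A : Ty Sg.S, Sg.V A

/-- Substitutions: type-preserving maps from variables to terms. -/
abbrev Subst (Sg : Signature.{u, v, w, z}) := ∀ A : Ty Sg.S, Sg.V A → Term Sg A

variable {Sg : Signature.{u, v, w, z}}

namespace Term

/-- The variables occurring in a term. -/
def vars : {A : Ty Sg.S} → Term Sg A → Set (Var Sg)
  | _, fn _ => ∅
  | _, var x => {⟨_, x⟩}
  | _, app s t => s.vars ∪ t.vars

/-- Application of a substitution. -/
def subst (σ : Subst Sg) : {A : Ty Sg.S} → Term Sg A → Term Sg A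
  | _, fn f => fn f
  | _, var x => σ _ x
  | _, app s t => app (s.subst σ) (t.subst σ)

/-- The head `a` of a term `a t₁ ⋯ tₙ`: a function symbol or a variable. -/
def head : {A : Ty Sg.S} → Term Sg A → Sym Sg ⊕ Var Sg
  | _, fn f => Sum.inl ⟨_, f⟩
  | _, var x => Sum.inr ⟨_, x⟩
  | _, app s _ => s.head

/-- The arguments `[t₁, …, tₙ]` of a term `a t₁ ⋯ tₙ`. -/
def args : {A : Ty Sg.S} → Term Sg A → List (Tm Sg)
  | _, fn _ => []
  | _, var _ => []
  | _, app s t => s.args ++ [⟨_, t⟩]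

/-- Neutral terms: `x t₁ ⋯ tₙ` for a variable `x`. -/
def IsNeutral {A : Ty Sg.S} (t : Term Sg A) : Prop :=
  ∃ x, t.head = Sum.inr x

/-- The proper (maximally applied) subterms of `a t₁ ⋯ tₙ`: the `tᵢ` and their proper subterms.
In `app s t`, the part `s` is not itself a subterm. -/
def ProperSubterm : {A : Ty Sg.S} → Term Sg A → Tm Sg → Prop
  | _, fn _, _ => False
  | _, var _, _ => False
  | _, app s t, u => u = ⟨_, t⟩ ∨ t.ProperSubterm u ∨ s.ProperSubterm u

/-- The (maximally applied) subterms of a term. -/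
def Subterm {A : Ty Sg.S} (s : Term Sg A) (u : Tm Sg) : Prop :=
  u = ⟨A, s⟩ ∨ s.ProperSubterm u

/-- Patterns: every subterm is either `f t₁ ⋯ tₙ` for a function symbol `f`, or a variable. -/
def IsPattern {A : Ty Sg.S} (t : Term Sg A) : Prop :=
  ∀ u : Tm Sg, t.Subterm u →
    (∃ f, u.2.head = Sum.inl f) ∨ ∃ (B : Ty Sg.S) (x : Sg.V B), u = ⟨B, var x⟩

/-- Theory terms: all function symbols are theory symbols. -/
def IsTheory : {A : Ty Sg.S} → Term Sg A → Prop
  | _, fn f => Sg.theorySym f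
  | _, var _ => True
  | _, app s t => s.IsTheory ∧ t.IsTheory

/-- Ground theory terms: theory terms without variables. -/
def IsGroundTheory : {A : Ty Sg.S} → Term Sg A → Prop
  | _, fn f => Sg.theorySym f
  | _, var _ => False
  | _, app s t => s.IsGroundTheory ∧ t.IsGroundTheory

/-- Values: theory symbols whose type is a theory sort. -/
def IsValue : {A : Ty Sg.S} → Term Sg A → Prop
  | A, fn f => Sg.theorySym f ∧ A.IsSortIn Sg.theorySort
  | _, var _ => False
  | _, app _ _ => False

/-- The interpretation of ground theory terms. -/
def eval : {A : Ty Sg.S} → (t : Term Sg A) → t.IsGroundTheory → A.Den Sg.X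
  | _, fn f, h => Sg.interp f h
  | _, var _, h => h.elim
  | _, app s t, h => (s.eval h.1) (t.eval h.2)

/-- `φ` is a ground theory term that is interpreted as true. -/
def Holds (φ : Term Sg (Ty.base Sg.bool)) : Prop :=
  ∃ h : φ.IsGroundTheory, Sg.boolEquiv (φ.eval h) = true

/-- Logical constraints: theory terms of type `bool` whose variables have theory sorts as types. -/
def IsConstraint (φ : Term Sg (Ty.base Sg.bool)) : Prop :=
  φ.IsTheory ∧ ∀ x ∈ φ.vars, x.1.IsSortIn Sg.theorySort

end Term

/-! ### Constrained rewriting -/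

/-- Constrained rewrite rules `lhs → rhs [constr]`. -/
structure Rule (Sg : Signature.{u, v, w, z}) where
  ty : Ty Sg.S
  lhs : Term Sg ty
  rhs : Term Sg ty
  constr : Term Sg (Ty.base Sg.bool)
  constr_ok : constr.IsConstraint
  rhs_vars : ∀ x ∈ rhs.vars \ lhs.vars, x.1.IsSortIn Sg.theorySort
  lhs_pattern : lhs.IsPattern
  lhs_head : ∃ f, lhs.head = Sum.inl f
  /-- the left-hand side contains a function symbol that is not a theory symbol -/
  lhs_not_theory : ¬ lhs.IsTheory

/-- The variables that must be instantiated by values (theory terms) when the rule is used. -/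
def Rule.logicVars (ρ : Rule Sg) : Set (Var Sg) :=
  ρ.constr.vars ∪ (ρ.rhs.vars \ ρ.lhs.vars)

/-- A substitution respects a rewrite rule. -/
def Rule.Respects (ρ : Rule Sg) (σ : Subst Sg) : Prop :=
  (∀ x ∈ ρ.logicVars, (σ x.1 x.2).IsValue) ∧ (ρ.constr.subst σ).Holds

/-- Calculation at the root: `f v₁ ⋯ vₙ` with `n > 0`, a theory symbol `f` and values `vᵢ`, is
replaced by the value with the same interpretation. -/
def Calc {A : Ty Sg.S} (s v : Term Sg A) : Prop :=
  (∃ f : Sym Sg, s.head = Sum.inl f ∧ Sg.theorySym f.2) ∧ s.args ≠ [] ∧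
    (∀ a ∈ s.args, a.2.IsValue) ∧ v.IsValue ∧
    ∃ (hs : s.IsGroundTheory) (hv : v.IsGroundTheory), s.eval hs = v.eval hv

/-- The rewrite relation of a set `R` of rewrite rules: rule steps and calculation steps, closed
under contexts. -/
inductive Step (R : Set (Rule Sg)) : {A : Ty Sg.S} → Term Sg A → Term Sg A → Prop
  | rule (ρ : Rule Sg) (hρ : ρ ∈ R) (σ : Subst Sg) (hσ : ρ.Respects σ) :
      Step R (ρ.lhs.subst σ) (ρ.rhs.subst σ)
  | calc {A : Ty Sg.S} (s v : Term Sg A) (h : Calc s v) : Step R s v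
  | appL {A B : Ty Sg.S} (s s' : Term Sg (Ty.arr A B)) (t : Term Sg A) (h : Step R s s') :
      Step R (Term.app s t) (Term.app s' t)
  | appR {A B : Ty Sg.S} (s : Term Sg (Ty.arr A B)) (t t' : Term Sg A) (h : Step R t t') :
      Step R (Term.app s t) (Term.app s t')

/-- No infinite `r`-sequence starts from `a`. -/
def TerminatingFrom {α : Type*} (r : α → α → Prop) (a : α) : Prop :=
  ¬ ∃ c : ℕ → α, c 0 = a ∧ ∀ n, r (c n) (c (n + 1))

/-- The system `R` is terminating: every term is. -/
def Terminating (R : Set (Rule Sg)) : Prop :=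
  ∀ (A : Ty Sg.S) (t : Term Sg A), TerminatingFrom (Step R) t

/-- Defined symbols. -/
def Defined (R : Set (Rule Sg)) {A : Ty Sg.S} (f : Sg.F A) : Prop :=
  ∃ ρ ∈ R, ρ.lhs.head = Sum.inl ⟨A, f⟩

/-! ### Accessibility -/

/-- Sort orderings: quasi-orderings with well-founded strict part. -/
structure SortOrdering (S : Type u) where
  ge : S → S → Prop
  refl : ∀ a, ge a a
  trans : ∀ a b c, ge a b → ge b c → ge a c
  wf : WellFounded (fun a b => ge b a ∧ ¬ ge a b)

/-- The strict part of a sort ordering. -/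
def SortOrdering.gt {S : Type u} (o : SortOrdering S) (a b : S) : Prop :=
  o.ge a b ∧ ¬ o.ge b a

mutual
/-- For `B = B₁ → ⋯ → Bₙ → C`: `a ≿ C` and each `Bᵢ` satisfies `Neg`. -/
def SortOrdering.Pos {S : Type u} (o : SortOrdering S) (a : S) : Ty S → Prop
  | Ty.base c => o.ge a c
  | Ty.arr A B => SortOrdering.Neg o a A ∧ SortOrdering.Pos o a B
/-- For `B = B₁ → ⋯ → Bₙ → C`: `a ≻ C` and each `Bᵢ` satisfies `Pos`. -/
def SortOrdering.Neg {S : Type u} (o : SortOrdering S) (a : S) : Ty S → Prop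
  | Ty.base c => o.gt a c
  | Ty.arr A B => SortOrdering.Pos o a A ∧ SortOrdering.Neg o a B
end

/-- The accessible argument positions (counted from `0`) of a function symbol. -/
def accPos (o : SortOrdering Sg.S) (f : Sym Sg) : Set ℕ :=
  {k | ∃ A, f.1.args[k]? = some A ∧ o.Pos f.1.target A}

/-- `s = f s₁ ⋯ sₘ` for a function symbol `f`, and `t` is an argument of `s` at an accessible
position of `f`. -/
def AccArg (o : SortOrdering Sg.S) (s t : Tm Sg) : Prop :=
  ∃ f, s.2.head = Sum.inl f ∧ ∃ k ∈ accPos o f, s.2.args[k]? = some t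

/-- Accessible subterms. -/
inductive AccSubterm (o : SortOrdering Sg.S) : Tm Sg → Tm Sg → Prop
  | refl (s : Tm Sg) : AccSubterm o s s
  | step (s s' t : Tm Sg) (h : AccArg o s s') (h' : AccSubterm o s' t) : AccSubterm o s t

/-- `R` is accessible function passing with respect to the sort ordering `o`. -/
def AFPWith (R : Set (Rule Sg)) (o : SortOrdering Sg.S) : Prop :=
  ∀ ρ ∈ R, ∀ x ∈ (ρ.lhs.vars ∩ ρ.rhs.vars) \ ρ.constr.vars,
    ∃ s ∈ ρ.lhs.args, AccSubterm o s ⟨x.1, Term.var x.2⟩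

/-! ### Computability -/

/-- A family of sets of terms of base type, indexed by the sorts. -/
abbrev Family (Sg : Signature.{u, v, w, z}) := ∀ a : Sg.S, Set (Term Sg (Ty.base a))

/-- Sets of reducibility candidates for the rewrite relation of `R`. -/
structure IsRCSet (R : Set (Rule Sg)) (I : Family Sg) : Prop where
  terminating : ∀ a, ∀ t ∈ I a, TerminatingFrom (Step R) t
  closed : ∀ a, ∀ s ∈ I a, ∀ t, Step R s t → t ∈ I a
  neutral : ∀ a (s : Term Sg (Ty.base a)), s.IsNeutral → (∀ t, Step R s t → t ∈ I a) → s ∈ I a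

/-- `I`-computable terms. -/
def IsComputable (I : Family Sg) : {A : Ty Sg.S} → Term Sg A → Prop
  | Ty.base a, t => t ∈ I a
  | Ty.arr A _, t => ∀ s : Term Sg A, IsComputable I s → IsComputable I (Term.app t s)

/-- `AppliedTo I s t`: `t = s t₁ ⋯ tₙ` for some `n ≥ 0` and some `I`-computable terms `tᵢ`. -/
inductive AppliedTo (I : Family Sg) {A : Ty Sg.S} (s : Term Sg A) :
    {B : Ty Sg.S} → Term Sg B → Prop
  | nil : AppliedTo I s s
  | snoc {B C : Ty Sg.S} (t : Term Sg (Ty.arr B C)) (t' : Term Sg B) (h : AppliedTo I s t)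
      (h' : IsComputable I t') : AppliedTo I s (Term.app t t')

/-- The relation `s ⇛_I t`: both terms have base types, `s = f s₁ ⋯ sₘ` for a function symbol `f`,
and `t = sₖ t₁ ⋯ tₙ` for an accessible position `k` of `f` and `I`-computable terms `tᵢ`. -/
def AccStep (o : SortOrdering Sg.S) (I : Family Sg) (s t : Tm Sg) : Prop :=
  (∃ a, s.1 = Ty.base a) ∧ (∃ b, t.1 = Ty.base b) ∧
    ∃ s' : Tm Sg, AccArg o s s' ∧ AppliedTo I s'.2 t.2

/-- The union of the rewrite relation of `R` and `⇛_I`. -/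
def StepOrAccStep (R : Set (Rule Sg)) (o : SortOrdering Sg.S) (I : Family Sg) (s t : Tm Sg) :
    Prop :=
  (∃ (A : Ty Sg.S) (s' t' : Term Sg A), s = ⟨A, s'⟩ ∧ t = ⟨A, t'⟩ ∧ Step R s' t') ∨ AccStep o I s t

/-- `C` is a computability predicate `ℂ` for `R` and the sort ordering `o`: an RC-set such that
`t ∈ C a` if and only if `t` is terminating with respect to the union of the rewrite relation and
`⇛_C`, and for each reduct `f t₁ ⋯ tₙ` of `t` with `f` a function symbol, the `tᵢ` at accessible
positions of `f` are `C`-computable. -/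
def IsComputabilitySet (R : Set (Rule Sg)) (o : SortOrdering Sg.S) (C : Family Sg) : Prop :=
  IsRCSet R C ∧ ∀ (a : Sg.S) (t : Term Sg (Ty.base a)), t ∈ C a ↔
    TerminatingFrom (StepOrAccStep R o C) ⟨_, t⟩ ∧
    ∀ t', Relation.ReflTransGen (Step R) t t' →
      ∀ u : Tm Sg, AccArg o ⟨_, t'⟩ u → IsComputable C u.2

/-! ### Static dependency pairs -/

/-- The terms over `F ∪ {f♯ | f defined}` whose type is `A₁ → ⋯ → Aₙ → dp`, indexed by the list
`[A₁, …, Aₙ]`.  Each symbol `f♯` gets the type of `f` with its target sort replaced by the fresh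
sort `dp`.  As `dp` does not occur in argument types, every such term is `f♯ t₁ ⋯ tₖ` with
unmarked terms `tᵢ`, and all other terms are unmarked. -/
inductive Marked (R : Set (Rule Sg)) : List (Ty Sg.S) → Type (max u v w)
  | sharp {A : Ty Sg.S} (f : Sg.F A) (hf : Defined R f) : Marked R A.args
  | app {A : Ty Sg.S} {L : List (Ty Sg.S)} (s : Marked R (A :: L)) (t : Term Sg A) : Marked R L

/-- The head of the term is a defined symbol. -/
def DefHeaded (R : Set (Rule Sg)) : {A : Ty Sg.S} → Term Sg A → Prop
  | _, Term.fn f => Defined R f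
  | _, Term.var _ => False
  | _, Term.app s _ => DefHeaded R s

theorem defHeaded_of_head (R : Set (Rule Sg)) {A : Ty Sg.S} (t : Term Sg A) (f : Sym Sg)
    (h : t.head = Sum.inl f) (hf : Defined R f.2) : DefHeaded R t := by
  induction t with
  | fn g =>
    simp only [Term.head, Sum.inl.injEq] at h
    subst h
    exact hf
  | var x => simp [Term.head] at h
  | app s t ih _ => exact ih h

theorem defHeaded_lhs {R : Set (Rule Sg)} {ρ : Rule Sg} (hρ : ρ ∈ R) : DefHeaded R ρ.lhs := by
  obtain ⟨f, hf⟩ := ρ.lhs_head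
  exact defHeaded_of_head R ρ.lhs f hf ⟨ρ, hρ, hf⟩

/-- The term `t♯ = f♯ t₁ ⋯ tₙ` for `t = f t₁ ⋯ tₙ` with `f` a defined symbol. -/
def mark (R : Set (Rule Sg)) : {A : Ty Sg.S} → (t : Term Sg A) → DefHeaded R t → Marked R A.args
  | _, Term.fn f, h => Marked.sharp f h
  | _, Term.var _, h => h.elim
  | _, Term.app s t, h => Marked.app (mark R s h) t

/-- Tuples of variables of given types. -/
def VarTuple (Sg : Signature.{u, v, w, z}) : List (Ty Sg.S) → Type w
  | [] => PUnit
  | A :: L => Sg.V A × VarTuple Sg L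

/-- The variables in a tuple. -/
def VarTuple.toList : {L : List (Ty Sg.S)} → VarTuple Sg L → List (Var Sg)
  | [], _ => []
  | A :: _, xs => ⟨A, xs.1⟩ :: VarTuple.toList xs.2

/-- The term `t x₁ ⋯ xₘ` of base type. -/
def Term.applyVars : {A : Ty Sg.S} → Term Sg A → VarTuple Sg A.args → Term Sg (Ty.base A.target)
  | Ty.base _, t, _ => t
  | Ty.arr _ B, t, xs => Term.applyVars (A := B) (Term.app t (Term.var xs.1)) xs.2

namespace Marked

variable {R : Set (Rule Sg)}

/-- The term `s x₁ ⋯ xₘ` of type `dp`, for a marked term `s`. -/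
def applyVars : {L : List (Ty Sg.S)} → Marked R L → VarTuple Sg L → Marked R []
  | [], s, _ => s
  | _ :: _, s, xs => applyVars (app s (Term.var xs.1)) xs.2

/-- Application of a substitution to a marked term. -/
def subst (σ : Subst Sg) : {L : List (Ty Sg.S)} → Marked R L → Marked R L
  | _, sharp f hf => sharp f hf
  | _, app s t => app (s.subst σ) (t.subst σ)

/-- The proper subterms of `f♯ t₁ ⋯ tₙ`, which are those of `f t₁ ⋯ tₙ`. -/
def ProperSubterm : {L : List (Ty Sg.S)} → Marked R L → Tm Sg → Prop
  | _, sharp _ _, _ => False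
  | _, app s t, u => u = ⟨_, t⟩ ∨ t.ProperSubterm u ∨ s.ProperSubterm u

/-- The rewrite relation of `R` on marked terms. -/
inductive Step : {L : List (Ty Sg.S)} → Marked R L → Marked R L → Prop
  | appL {A : Ty Sg.S} {L : List (Ty Sg.S)} (s s' : Marked R (A :: L)) (t : Term Sg A)
      (h : Step s s') : Step (app s t) (app s' t)
  | appR {A : Ty Sg.S} {L : List (Ty Sg.S)} (s : Marked R (A :: L)) (t t' : Term Sg A)
      (h : LCSTRS.Step R t t') : Step (app s t) (app s t')

end Marked

/-- Quadruples `src ⇒ tgt [constr | L]`, with `src` and `tgt` marked terms of type `dp`. -/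
structure DepPair (R : Set (Rule Sg)) where
  src : Marked R []
  tgt : Marked R []
  constr : Term Sg (Ty.base Sg.bool)
  L : Set (Var Sg)
  constr_ok : constr.IsConstraint
  vars_subset : constr.vars ⊆ L
  L_sorts : ∀ x ∈ L, x.1.IsSortIn Sg.theorySort

/-- A substitution respects a static dependency pair. -/
def DepPair.Respects {R : Set (Rule Sg)} (d : DepPair R) (σ : Subst Sg) : Prop :=
  (∀ x ∈ d.L, (σ x.1 x.2).IsGroundTheory) ∧ (d.constr.subst σ).Holds

/-- The static dependency pairs `ℓ♯ x₁ ⋯ xₘ ⇒ g♯ t₁ ⋯ t_q y_{q+1} ⋯ yₙ [φ | L]` of the rules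
`ℓ → r [φ]` in `R`: here `g t₁ ⋯ t_q` is a subterm of `r x₁ ⋯ xₘ` with `g` defined, and the
variables `xᵢ` and `yⱼ` are fresh. -/
def SDP (R : Set (Rule Sg)) : Set (DepPair R) :=
  {d | ∃ (ρ : Rule Sg) (hρ : ρ ∈ R) (xs : VarTuple Sg ρ.ty.args) (A : Ty Sg.S) (t : Term Sg A)
      (ht : DefHeaded R t) (ys : VarTuple Sg A.args),
    (ρ.rhs.applyVars xs).Subterm ⟨A, t⟩ ∧
    (xs.toList ++ ys.toList).Nodup ∧
    (∀ x ∈ xs.toList ++ ys.toList, x ∉ ρ.lhs.vars ∪ ρ.rhs.vars ∪ ρ.constr.vars) ∧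
    d.src = (mark R ρ.lhs (defHeaded_lhs hρ)).applyVars xs ∧
    d.tgt = (mark R t ht).applyVars ys ∧
    d.constr = ρ.constr ∧
    d.L = ρ.logicVars}

/-! ### Chains -/

/-- The sequence `(d 0, σ 0), (d 1, σ 1), …` is an infinite `(P, R)`-chain. -/
def IsInfiniteChain {R : Set (Rule Sg)} (P : Set (DepPair R)) (d : ℕ → DepPair R)
    (σ : ℕ → Subst Sg) : Prop :=
  ∀ i, d i ∈ P ∧ (d i).Respects (σ i) ∧
    Relation.ReflTransGen Marked.Step ((d i).tgt.subst (σ i)) ((d (i + 1)).src.subst (σ (i + 1)))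

/-- The chain is computable with respect to `C`. -/
def IsComputableChain {R : Set (Rule Sg)} (C : Family Sg) (d : ℕ → DepPair R)
    (σ : ℕ → Subst Sg) : Prop :=
  ∀ i, ∀ u : Tm Sg, (d i).tgt.ProperSubterm u → IsComputable C (u.2.subst (σ i))

end LCSTRS

open LCSTRS

namespace LCSTRS

variable {Sg : Signature.{u, v, w, z}} {R : Set (Rule Sg)} {o : SortOrdering Sg.S}
  {C : Family Sg}

-- Existence. The condition that should characterize `C` refers to `C` itself, so it must be read as
-- a fixed-point equation. For terms of sort `b`, an accessible argument has a type that is positive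
-- with respect to `b`: sorts equivalent to `b` occur in it only covariantly, and what occurs
-- contravariantly lies strictly below. Hence, once `C` is fixed on the strictly smaller sorts, the
-- condition is monotone on the class of `b`: enlarging the candidate makes more accessible
-- arguments computable and creates no new `AccStep` (`LEBelow.accComputable`). Knaster–Tarski gives
-- a least fixed point, and well-founded recursion on sorts assembles these
-- (`mem_computabilityFamily`).
--
-- Termination. Computable terms terminate and are closed under application, and variables are
-- computable, so it suffices that every function symbol is computable. Otherwise there is a
-- `MinimalTerm`: a non-computable base-type term with defined head and computable arguments. Its
-- arguments terminate, so finitely many argument steps lead to a rule step at the head whose result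
-- is still non-computable (`IsComputabilitySet.exists_rootStep`). By accessible function passing,
-- the rule's substitution is computable on the variables of the right-hand side. Hence a minimal
-- non-computable subterm of the right-hand side, extended by fresh variables, must have a defined
-- head (`IsComputabilitySet.exists_minimal`). This yields a dependency pair, and applying the
-- instance of that subterm to suitable computable arguments gives the next minimal term
-- (`MinimalTerm.exists_next`). Iterating produces an infinite computable chain.

theorem terminatingFrom_iff_acc {α : Type*} {r : α → α → Prop} {a : α} :
    TerminatingFrom r a ↔ Acc (fun x y => r y x) a := by
  rw [← not_iff_not, not_acc_iff_exists_descending_chain, TerminatingFrom, not_not]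

/-! ### Positions of arguments -/

theorem Term.args_target_of_head {f : Sym Sg} {A : Ty Sg.S} (t : Term Sg A)
    (h : t.head = Sum.inl f) :
    f.1.args = t.args.map Sigma.fst ++ A.args ∧ f.1.target = A.target := by
  induction t with
  | fn g =>
    simp only [Term.head, Sum.inl.injEq] at h
    subst h
    simp [Term.args]
  | var x => simp [Term.head] at h
  | app s t ih _ =>
    obtain ⟨h₁, h₂⟩ := ih h
    exact ⟨by simp [h₁, Term.args, Ty.args], h₂⟩

/-- At base type the head symbol is fully applied, so its target sort is `a` and its declared
argument types are those of the actual arguments. -/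
theorem AccArg.pos {a : Sg.S} {s t : Tm Sg} (hs : s.1 = Ty.base a) (h : AccArg o s t) :
    o.Pos a t.1 := by
  obtain ⟨A, s⟩ := s
  obtain ⟨f, hf, k, ⟨B, hB, hpos⟩, ht⟩ := h
  obtain ⟨h₁, h₂⟩ := s.args_target_of_head hf
  dsimp only at hs
  subst hs
  have hk : (s.args.map Sigma.fst)[k]? = some t.1 := by simp [ht]
  have : f.1.args[k]? = some t.1 := by rw [h₁]; simpa [Ty.args] using hk
  rw [this] at hB
  cases hB
  rwa [h₂] at hpos

theorem SortOrdering.gt_of_ge_of_gt {S : Type u} (o : SortOrdering S) {a b c : S}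
    (h : o.ge a b) (h' : o.gt b c) : o.gt a c :=
  ⟨o.trans _ _ _ h h'.1, fun hc => h'.2 (o.trans _ _ _ hc h)⟩

/-! ### Monotonicity of computability -/

/-- `I` is contained in `J` at the sorts below `a`, and equal to it at those strictly below. -/
def LEBelow (o : SortOrdering Sg.S) (a : Sg.S) (I J : Family Sg) : Prop :=
  (∀ b, o.ge a b → I b ⊆ J b) ∧ ∀ b, o.gt a b → I b = J b

/-- Both directions need a joint induction, since the left of an arrow exchanges `Pos` and `Neg`. At
a base sort, `Neg` means strictly below, where the two families agree. -/
theorem LEBelow.computable {a : Sg.S} {I J : Family Sg} (h : LEBelow o a I J) {b : Sg.S}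
    (hb : o.ge a b) (A : Ty Sg.S) :
    (o.Pos b A → ∀ t : Term Sg A, IsComputable I t → IsComputable J t) ∧
    (o.Neg b A → ∀ t : Term Sg A, IsComputable J t → IsComputable I t) := by
  induction A with
  | base c =>
    simp only [SortOrdering.Pos, SortOrdering.Neg, IsComputable]
    refine ⟨fun hc t ht => h.1 c (o.trans _ _ _ hb hc) ht, fun hc t ht => ?_⟩
    rwa [h.2 c (o.gt_of_ge_of_gt hb hc)]
  | arr A B ihA ihB =>
    simp only [SortOrdering.Pos, SortOrdering.Neg, IsComputable]
    exact ⟨fun hp t ht s hs => ihB.1 hp.2 _ (ht s (ihA.2 hp.1 s hs)),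
      fun hp t ht s hs => ihB.2 hp.2 _ (ht s (ihA.1 hp.1 s hs))⟩

theorem LEBelow.appliedTo {a : Sg.S} {I J : Family Sg} (h : LEBelow o a I J) {b : Sg.S}
    (hb : o.ge a b) {A : Ty Sg.S} {s : Term Sg A} (hA : o.Pos b A) {B : Ty Sg.S}
    {t : Term Sg B} (ht : AppliedTo J s t) : AppliedTo I s t ∧ o.Pos b B := by
  induction ht with
  | nil => exact ⟨.nil, hA⟩
  | snoc t t' _ h' ih =>
    have hp := ih.2
    simp only [SortOrdering.Pos] at hp
    exact ⟨.snoc t t' ih.1 ((h.computable hb _).2 hp.1 t' h'), hp.2⟩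

/-- The terms to which an accessible argument is applied have `Neg` types, so the larger family
admits no additional steps. The bound on the sort of `t` keeps later steps below `a`. -/
theorem LEBelow.accStep {a : Sg.S} {I J : Family Sg} (h : LEBelow o a I J) {b : Sg.S}
    (hb : o.ge a b) {s t : Tm Sg} (hs : s.1 = Ty.base b) (hst : AccStep o J s t) :
    AccStep o I s t ∧ ∃ c, t.1 = Ty.base c ∧ o.ge b c := by
  obtain ⟨h₁, ⟨c, hc⟩, s', hs', hap⟩ := hst
  obtain ⟨h₃, h₄⟩ := h.appliedTo hb (hs'.pos hs) hap
  rw [hc] at h₄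
  exact ⟨⟨h₁, ⟨c, hc⟩, s', hs', h₃⟩, c, hc, by simpa [SortOrdering.Pos] using h₄⟩

theorem LEBelow.acc {a : Sg.S} {I J : Family Sg} (h : LEBelow o a I J) {s : Tm Sg}
    (hs : Acc (fun x y => StepOrAccStep R o I y x) s) :
    ∀ b, o.ge a b → s.1 = Ty.base b → Acc (fun x y => StepOrAccStep R o J y x) s := by
  induction hs with
  | intro s _ ih =>
    intro b hb hsb
    refine ⟨_, fun t ht => ?_⟩
    rcases ht with ⟨A, s', t', rfl, rfl, hst⟩ | hst
    · exact ih _ (.inl ⟨A, s', t', rfl, rfl, hst⟩) b hb hsb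
    · obtain ⟨h₁, c, hc, hbc⟩ := h.accStep hb hsb hst
      exact ih _ (.inr h₁) c (o.trans _ _ _ hb hbc) hc

/-- The condition characterizing membership in a computability predicate. -/
def AccComputable (R : Set (Rule Sg)) (o : SortOrdering Sg.S) (I : Family Sg) (a : Sg.S)
    (t : Term Sg (Ty.base a)) : Prop :=
  TerminatingFrom (StepOrAccStep R o I) ⟨_, t⟩ ∧
    ∀ t', Relation.ReflTransGen (Step R) t t' →
      ∀ u : Tm Sg, AccArg o ⟨_, t'⟩ u → IsComputable I u.2

theorem LEBelow.accComputable {a : Sg.S} {I J : Family Sg} (h : LEBelow o a I J) {b : Sg.S}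
    (hb : o.ge a b) {t : Term Sg (Ty.base b)} (ht : AccComputable R o I b t) :
    AccComputable R o J b t := by
  refine ⟨?_, fun t' ht' u hu => (h.computable hb _).1 (hu.pos rfl) _ (ht.2 t' ht' u hu)⟩
  have := ht.1
  rw [terminatingFrom_iff_acc] at this ⊢
  exact h.acc this b hb rfl

/-! ### Existence of computability predicates -/

/-- `C` at the sorts strictly below `a`, and `I` elsewhere. -/
def belowOr (o : SortOrdering Sg.S) (a : Sg.S) (C I : Family Sg) : Family Sg :=
  fun b => {t | (o.gt a b ∧ t ∈ C b) ∨ (¬ o.gt a b ∧ t ∈ I b)}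

theorem belowOr_of_gt {a b : Sg.S} (h : o.gt a b) (C I : Family Sg) :
    belowOr o a C I b = C b := by
  ext t; simp [belowOr, h]

theorem belowOr_of_not_gt {a b : Sg.S} (h : ¬ o.gt a b) (C I : Family Sg) :
    belowOr o a C I b = I b := by
  ext t; simp [belowOr, h]

theorem leBelow_belowOr (a : Sg.S) (C : Family Sg) {I J : Family Sg} (h : I ≤ J) :
    LEBelow o a (belowOr o a C I) (belowOr o a C J) := by
  constructor
  · rintro b - t (ht | ht)
    · exact .inl ht
    · exact .inr ⟨ht.1, h b ht.2⟩
  · intro b hb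
    rw [belowOr_of_gt hb, belowOr_of_gt hb]

/-- The monotone operator whose least fixed point is the computability predicate at the sorts
equivalent to `a`, when `C` is the computability predicate at the smaller sorts. -/
def candidateOp (R : Set (Rule Sg)) (o : SortOrdering Sg.S) (a : Sg.S) (C : Family Sg) :
    Family Sg →o Family Sg where
  toFun I b := {t | o.ge a b ∧ AccComputable R o (belowOr o a C I) b t}
  monotone' _ _ h _ _ ht := ⟨ht.1, (leBelow_belowOr a C h).accComputable ht.1 ht.2⟩

/-- Equivalent sorts thus share a single least fixed point, although the recursion treats each sort
separately. -/
theorem candidateOp_congr {a b : Sg.S} (hab : o.ge a b) (hba : o.ge b a) {C D : Family Sg}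
    (h : ∀ c, o.gt a c → C c = D c) : candidateOp R o a C = candidateOp R o b D := by
  have hgt : ∀ c, o.gt a c ↔ o.gt b c := fun c =>
    ⟨o.gt_of_ge_of_gt hba, o.gt_of_ge_of_gt hab⟩
  have hge : ∀ c, o.ge a c ↔ o.ge b c := fun c => ⟨o.trans _ _ _ hba, o.trans _ _ _ hab⟩
  have hbelow : ∀ I, belowOr o a C I = belowOr o b D I := by
    intro I
    funext c
    by_cases hc : o.gt a c
    · rw [belowOr_of_gt hc, belowOr_of_gt ((hgt c).1 hc), h c hc]
    · rw [belowOr_of_not_gt hc, belowOr_of_not_gt (mt (hgt c).2 hc)]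
  ext I c t
  change (o.ge a c ∧ AccComputable R o (belowOr o a C I) c t) ↔
    (o.ge b c ∧ AccComputable R o (belowOr o b D I) c t)
  rw [hge, hbelow]

open Classical in
/-- A computability predicate, constructed by recursion on the sort ordering. -/
noncomputable def computabilityFamily (R : Set (Rule Sg)) (o : SortOrdering Sg.S) : Family Sg :=
  o.wf.fix fun a C =>
    -- The default `∅` is harmless: `belowOr` reads this family only strictly below `a`.
    (candidateOp R o a fun b => if h : o.ge a b ∧ ¬ o.ge b a then C b h else ∅).lfp a

theorem computabilityFamily_eq (a : Sg.S) : computabilityFamily R o a =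
    (candidateOp R o a (computabilityFamily R o)).lfp a := by
  rw [computabilityFamily, o.wf.fix_eq]
  exact congrArg (fun G : Family Sg →o Family Sg => G.lfp a)
    (candidateOp_congr (o.refl a) (o.refl a) fun c hc => dif_pos hc)

theorem mem_computabilityFamily (a : Sg.S) (t : Term Sg (Ty.base a)) :
    t ∈ computabilityFamily R o a ↔ AccComputable R o (computabilityFamily R o) a t := by
  set C := computabilityFamily R o with hC
  set I := (candidateOp R o a C).lfp with hI
  -- The fixed point taken at `a` is the right family at all sorts up to `a`, not only at `a`:
  -- equivalent sorts have the same operator.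
  have hbelow : ∀ b, o.ge a b → belowOr o a C I b = C b := by
    intro b hb
    by_cases hba : o.ge b a
    · rw [belowOr_of_not_gt fun h => h.2 hba, hI,
        candidateOp_congr hb hba (D := C) fun _ _ => rfl, hC]
      exact (computabilityFamily_eq b).symm
    · exact belowOr_of_gt ⟨hb, hba⟩ _ _
  have h₁ : C a = candidateOp R o a C I a := by
    rw [hI, OrderHom.map_lfp]
    exact computabilityFamily_eq a
  have h₂ : t ∈ C a ↔ AccComputable R o (belowOr o a C I) a t := by
    rw [h₁]
    exact ⟨fun h => h.2, fun h => ⟨o.refl a, h⟩⟩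
  rw [h₂]
  constructor
  · exact LEBelow.accComputable (a := a)
      ⟨fun b hb => (hbelow b hb).subset, fun b hb => hbelow b hb.1⟩ (o.refl a)
  · exact LEBelow.accComputable (a := a)
      ⟨fun b hb => (hbelow b hb).symm.subset, fun b hb => (hbelow b hb.1).symm⟩ (o.refl a)

theorem Term.IsNeutral.not_accArg {A : Ty Sg.S} {s : Term Sg A} (hs : s.IsNeutral) (t : Tm Sg) :
    ¬ AccArg o ⟨A, s⟩ t := by
  rintro ⟨f, hf, -⟩
  obtain ⟨x, hx⟩ := hs
  simp [hx] at hf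

/-- The RC-set axioms follow from the fixed-point equation alone; for neutral terms the point is
that they have no accessible arguments. -/
theorem isRCSet_of_mem_iff {C : Family Sg}
    (hC : ∀ a t, t ∈ C a ↔ AccComputable R o C a t) : IsRCSet R C where
  terminating a t ht := by
    rintro ⟨c, hc₀, hc⟩
    exact ((hC a t).1 ht).1
      ⟨fun n => ⟨_, c n⟩, by simp [hc₀], fun n => .inl ⟨_, _, _, rfl, rfl, hc n⟩⟩
  closed a s hs t hst := by
    obtain ⟨h₁, h₂⟩ := (hC a s).1 hs
    rw [terminatingFrom_iff_acc] at h₁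
    exact (hC a t).2 ⟨terminatingFrom_iff_acc.2 (h₁.inv (.inl ⟨_, _, _, rfl, rfl, hst⟩)),
      fun t' ht' => h₂ t' (.head hst ht')⟩
  neutral a s hs h := by
    refine (hC a s).2 ⟨?_, fun t' ht' u hu => ?_⟩
    · rw [terminatingFrom_iff_acc]
      refine ⟨_, ?_⟩
      rintro t (⟨A, s', t', h₁, rfl, hst⟩ | ⟨-, -, u, hu, -⟩)
      · cases h₁
        exact terminatingFrom_iff_acc.1 ((hC a t').1 (h t' hst)).1
      · exact (hs.not_accArg u hu).elim
    · rcases ht'.cases_head with rfl | ⟨s', hs', ht'⟩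
      · exact (hs.not_accArg u hu).elim
      · exact ((hC a s').1 (h s' hs')).2 t' ht' u hu

theorem isComputabilitySet_computabilityFamily (R : Set (Rule Sg)) (o : SortOrdering Sg.S) :
    IsComputabilitySet R o (computabilityFamily R o) :=
  ⟨isRCSet_of_mem_iff mem_computabilityFamily, mem_computabilityFamily⟩

/-! ### Heads, arguments and variables -/

theorem Term.head_subst {A : Ty Sg.S} (t : Term Sg A) (σ : Subst Sg) {f : Sym Sg}
    (h : t.head = Sum.inl f) : (t.subst σ).head = Sum.inl f := by
  induction t with
  | fn g => exact h
  | var x => simp [Term.head] at h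
  | app s t ih _ => exact ih h

theorem Term.args_subst {A : Ty Sg.S} (t : Term Sg A) (σ : Subst Sg) {f : Sym Sg}
    (h : t.head = Sum.inl f) :
    (t.subst σ).args = t.args.map fun u => ⟨u.1, u.2.subst σ⟩ := by
  induction t with
  | fn g => rfl
  | var x => simp [Term.head] at h
  | app s t ih _ => simp [Term.subst, Term.args, ih h]

theorem Term.subst_congr {A : Ty Sg.S} (t : Term Sg A) {σ τ : Subst Sg}
    (h : ∀ x ∈ t.vars, σ x.1 x.2 = τ x.1 x.2) : t.subst σ = t.subst τ := by
  induction t with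
  | fn g => rfl
  | var x => exact h ⟨_, x⟩ rfl
  | app s t ih₁ ih₂ =>
    simp only [Term.subst]
    rw [ih₁ fun x hx => h x (.inl hx), ih₂ fun x hx => h x (.inr hx)]

theorem Term.finite_vars {A : Ty Sg.S} (t : Term Sg A) : t.vars.Finite := by
  induction t with
  | fn g => exact Set.finite_empty
  | var x => exact Set.finite_singleton _
  | app s t ih₁ ih₂ => exact ih₁.union ih₂

theorem Term.ProperSubterm.vars_subset {A : Ty Sg.S} {t : Term Sg A} {u : Tm Sg}
    (h : t.ProperSubterm u) : u.2.vars ⊆ t.vars := by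
  induction t with
  | fn g => exact h.elim
  | var x => exact h.elim
  | app s t ih₁ ih₂ =>
    rcases h with rfl | h | h
    · exact Set.subset_union_right
    · exact (ih₂ h).trans Set.subset_union_right
    · exact (ih₁ h).trans Set.subset_union_left

theorem Term.Subterm.vars_subset {A : Ty Sg.S} {t : Term Sg A} {u : Tm Sg}
    (h : t.Subterm u) : u.2.vars ⊆ t.vars := by
  rcases h with rfl | h
  · exact subset_rfl
  · exact h.vars_subset

theorem Term.properSubterm_of_mem_args {A : Ty Sg.S} {t : Term Sg A} {u : Tm Sg}
    (h : u ∈ t.args) : t.ProperSubterm u := by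
  induction t with
  | fn g => simp [Term.args] at h
  | var x => simp [Term.args] at h
  | app s t ih₁ ih₂ =>
    simp only [Term.args, List.mem_append, List.mem_singleton] at h
    exact h.symm.imp id fun h => .inr (ih₁ h)

theorem AccArg.mem_args {s t : Tm Sg} (h : AccArg o s t) : t ∈ s.2.args := by
  obtain ⟨f, -, k, -, hk⟩ := h
  exact List.mem_of_getElem? hk

theorem AccArg.subst {s t : Tm Sg} (h : AccArg o s t) (σ : Subst Sg) :
    AccArg o ⟨s.1, s.2.subst σ⟩ ⟨t.1, t.2.subst σ⟩ := by
  obtain ⟨f, hf, k, hk, ht⟩ := h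
  refine ⟨f, s.2.head_subst σ hf, k, hk, ?_⟩
  simp [s.2.args_subst σ hf, ht]

theorem AccArg.app {A B : Ty Sg.S} {s : Term Sg (Ty.arr A B)} {t : Tm Sg}
    (h : AccArg o ⟨_, s⟩ t) (u : Term Sg A) : AccArg o ⟨B, Term.app s u⟩ t := by
  obtain ⟨f, hf, k, hk, ht⟩ := h
  have ht : s.args[k]? = some t := ht
  refine ⟨f, hf, k, hk, ?_⟩
  obtain ⟨hlt, -⟩ := List.getElem?_eq_some_iff.1 ht
  simp only [Term.args]
  rw [List.getElem?_append_left hlt, ht]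

/-! ### Steps at the root and below it -/

/-- Rule steps at the root of a prefix of the term. -/
inductive RootStep (R : Set (Rule Sg)) : {A : Ty Sg.S} → Term Sg A → Term Sg A → Prop
  | rule (ρ : Rule Sg) (hρ : ρ ∈ R) (σ : Subst Sg) (hσ : ρ.Respects σ) :
      RootStep R (ρ.lhs.subst σ) (ρ.rhs.subst σ)
  | app {A B : Ty Sg.S} (s s' : Term Sg (Ty.arr A B)) (t : Term Sg A) (h : RootStep R s s') :
      RootStep R (Term.app s t) (Term.app s' t)

/-- Steps inside an argument of the term. -/
inductive ArgStep (R : Set (Rule Sg)) : {A : Ty Sg.S} → Term Sg A → Term Sg A → Prop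
  | appL {A B : Ty Sg.S} (s s' : Term Sg (Ty.arr A B)) (t : Term Sg A) (h : ArgStep R s s') :
      ArgStep R (Term.app s t) (Term.app s' t)
  | appR {A B : Ty Sg.S} (s : Term Sg (Ty.arr A B)) (t t' : Term Sg A) (h : Step R t t') :
      ArgStep R (Term.app s t) (Term.app s t')

theorem Term.IsValue.isSortIn {A : Ty Sg.S} {v : Term Sg A} (h : v.IsValue) :
    A.IsSortIn Sg.theorySort := by
  cases v with
  | fn f => exact h.2
  | var x => exact h.elim
  | app s t => exact h.elim

theorem Step.arg_or_root_or_calc {A : Ty Sg.S} {s t : Term Sg A} (h : Step R s t) :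
    ArgStep R s t ∨ RootStep R s t ∨ Calc s t := by
  induction h with
  | rule ρ hρ σ hσ => exact .inr (.inl (.rule ρ hρ σ hσ))
  | appL s s' t h ih =>
    rcases ih with h | h | h
    · exact .inl (.appL _ _ _ h)
    · exact .inr (.inl (.app _ _ _ h))
    -- A calculation step below an application would produce a value of arrow type.
    · exact (h.2.2.2.1.isSortIn).elim
  | appR s t t' h _ => exact .inl (.appR _ _ _ h)
  | _ s v h => exact .inr (.inr h)

theorem ArgStep.step {A : Ty Sg.S} {s t : Term Sg A} (h : ArgStep R s t) : Step R s t := by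
  induction h with
  | appL s s' t h ih => exact .appL _ _ _ ih
  | appR s t t' h => exact .appR _ _ _ h

theorem ArgStep.head_eq {A : Ty Sg.S} {s t : Term Sg A} (h : ArgStep R s t) :
    t.head = s.head := by
  induction h with
  | appL s s' t h ih => exact ih
  | appR s t t' h => rfl

theorem RootStep.head_defined {A : Ty Sg.S} {s t : Term Sg A} (h : RootStep R s t) :
    ∃ f : Sym Sg, s.head = Sum.inl f ∧ Defined R f.2 := by
  induction h with
  | rule ρ hρ σ hσ =>
    obtain ⟨f, hf⟩ := ρ.lhs_head
    exact ⟨f, ρ.lhs.head_subst σ hf, ρ, hρ, hf⟩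
  | app s s' t h ih => exact ih

theorem Step.argStep_of_isNeutral {A : Ty Sg.S} {s t : Term Sg A} (h : Step R s t)
    (hs : s.IsNeutral) : ArgStep R s t := by
  obtain ⟨x, hx⟩ := hs
  rcases h.arg_or_root_or_calc with h | h | h
  · exact h
  · obtain ⟨f, hf, -⟩ := h.head_defined
    simp [hx] at hf
  · obtain ⟨f, hf, -⟩ := h.1
    simp [hx] at hf

theorem Term.isTheory_of_isValue_subst {A : Ty Sg.S} {t : Term Sg A} {σ : Subst Sg}
    {f : Sym Sg} (hf : t.head = Sum.inl f) (h : (t.subst σ).IsValue) : t.IsTheory := by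
  cases t with
  | fn f => exact h.1
  | var x => simp [Term.head] at hf
  | app s t => exact h.elim

/-- A left-hand side matching a value would be a single theory symbol, which rules exclude. -/
theorem Term.IsValue.not_step {A : Ty Sg.S} {v t : Term Sg A} (hv : v.IsValue) :
    ¬ Step R v t := by
  intro h
  rcases h.arg_or_root_or_calc with h | h | h
  · cases h <;> exact hv
  · cases h with
    | rule ρ hρ σ hσ =>
      obtain ⟨f, hf⟩ := ρ.lhs_head
      exact ρ.lhs_not_theory (Term.isTheory_of_isValue_subst hf hv)
    | app s s' t h => exact hv
  · cases v with
    | fn f => exact h.2.1 rfl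
    | var x => exact hv
    | app s t => exact hv

/-! ### Properties of computable terms -/

/-- The reducibility-candidate properties lift from sorts to all types. They are proved together:
termination at an arrow type needs a computable term to apply to, namely a variable, which is
supplied by the neutrality clause. -/
theorem IsRCSet.computable (hC : IsRCSet R C) (A : Ty Sg.S) :
    (∀ t : Term Sg A, IsComputable C t → Acc (fun x y => Step R y x) t) ∧
    (∀ t : Term Sg A, IsComputable C t → ∀ t', Step R t t' → IsComputable C t') ∧
    (∀ t : Term Sg A, t.IsNeutral → (∀ t', Step R t t' → IsComputable C t') →
      IsComputable C t) := by
  induction A with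
  | base a =>
    exact ⟨fun t ht => terminatingFrom_iff_acc.1 (hC.terminating a t ht), hC.closed a,
      hC.neutral a⟩
  | arr A B ihA ihB =>
    refine ⟨fun t ht => ?_, fun t ht t' htt' s hs => ?_, fun t hn ht s hs => ?_⟩
    · obtain ⟨x⟩ := (Sg.infinite_vars A).nonempty
      have hx : IsComputable C (Term.var x : Term Sg A) := by
        refine ihA.2.2 _ ⟨_, rfl⟩ fun t' ht' => ?_
        cases ht'.argStep_of_isNeutral ⟨_, rfl⟩
      have := InvImage.accessible (fun s => Term.app s (Term.var x)) (ihB.1 _ (ht _ hx))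
      exact Subrelation.accessible (fun h => Step.appL _ _ _ h) this
    · exact ihB.2.1 _ (ht s hs) _ (.appL _ _ _ htt')
    · have hacc := ihA.1 s hs
      induction hacc with
      | intro s _ ih =>
        refine ihB.2.2 _ hn fun t' ht' => ?_
        cases ht'.argStep_of_isNeutral hn with
        | appL _ t' _ h => exact ht t' h.step s hs
        | appR _ _ s' h => exact ih s' h (ihA.2.1 s hs s' h)

theorem IsRCSet.computable_var (hC : IsRCSet R C) {A : Ty Sg.S} (x : Sg.V A) :
    IsComputable C (Term.var x : Term Sg A) := by
  refine (hC.computable A).2.2 _ ⟨_, rfl⟩ fun t' ht' => ?_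
  cases ht'.argStep_of_isNeutral ⟨_, rfl⟩

/-- Applying `s` to variables until it reaches base type preserves both its computability and its
accessible arguments. -/
theorem IsComputabilitySet.accArg (hC : IsComputabilitySet R o C) {s t : Tm Sg}
    (hs : IsComputable C s.2) (h : AccArg o s t) : IsComputable C t.2 := by
  obtain ⟨A, s⟩ := s
  induction A with
  | base a => exact ((hC.2 a s).1 hs).2 s .refl t h
  | arr A B _ ih =>
    obtain ⟨x⟩ := (Sg.infinite_vars A).nonempty
    exact ih _ (hs _ (hC.1.computable_var x)) (h.app _)

theorem IsComputabilitySet.accSubterm (hC : IsComputabilitySet R o C) {s t : Tm Sg}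
    (h : AccSubterm o s t) {σ : Subst Sg} (hs : IsComputable C (s.2.subst σ)) :
    IsComputable C (t.2.subst σ) := by
  induction h with
  | refl => exact hs
  | step s s' t h _ ih =>
    exact ih (hC.accArg (s := ⟨s.1, s.2.subst σ⟩) (t := ⟨s'.1, s'.2.subst σ⟩) hs (h.subst σ))

theorem AppliedTo.computable {A B : Ty Sg.S} {s : Term Sg A} {t : Term Sg B}
    (h : AppliedTo C s t) (hs : IsComputable C s) : IsComputable C t := by
  induction h with
  | nil => exact hs
  | snoc t t' _ h' ih => exact ih t' h'

/-- An `AccStep` leads to a computable accessible argument applied to computable terms, hence into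
`C`, so only the rewrite steps need a hypothesis. -/
theorem IsComputabilitySet.mem_of_step (hC : IsComputabilitySet R o C) {a : Sg.S}
    {s : Term Sg (Ty.base a)} (hs : ∀ u : Tm Sg, AccArg o ⟨_, s⟩ u → IsComputable C u.2)
    (h : ∀ t, Step R s t → t ∈ C a) : s ∈ C a := by
  refine (hC.2 a s).2 ⟨?_, fun t' ht' u hu => ?_⟩
  · rw [terminatingFrom_iff_acc]
    refine ⟨_, ?_⟩
    rintro t (⟨A, s', t', h₁, rfl, hst⟩ | ⟨-, ⟨b, hb⟩, u, hu, hap⟩)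
    · cases h₁
      exact terminatingFrom_iff_acc.1 ((hC.2 a t').1 (h t' hst)).1
    · obtain ⟨B, t⟩ := t
      dsimp only at hb hap
      subst hb
      exact terminatingFrom_iff_acc.1 ((hC.2 b t).1 (hap.computable (hs u hu))).1
  · rcases ht'.cases_head with rfl | ⟨s', hs', ht'⟩
    · exact hs u hu
    · exact ((hC.2 a s').1 (h s' hs')).2 t' ht' u hu

theorem IsComputabilitySet.computable_of_isValue (hC : IsComputabilitySet R o C)
    {A : Ty Sg.S} {v : Term Sg A} (hv : v.IsValue) : IsComputable C v := by
  cases A with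
  | arr A B => exact hv.isSortIn.elim
  | base a =>
    refine hC.mem_of_step (fun u hu => ?_) fun t ht => (hv.not_step ht).elim
    have hmem := hu.mem_args
    cases v with
    | fn f => simp [Term.args] at hmem
    | var x => exact hv.elim
    | app s t => exact hv.elim

theorem ArgStep.args_computable (hC : IsRCSet R C) {A : Ty Sg.S} {s t : Term Sg A}
    (h : ArgStep R s t) (hs : ∀ u ∈ s.args, IsComputable C u.2) :
    ∀ u ∈ t.args, IsComputable C u.2 := by
  induction h with
  | appL s s' t h ih =>
    simp only [Term.args, List.mem_append, List.mem_singleton] at hs ⊢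
    rintro u (hu | rfl)
    · exact ih (fun u hu => hs u (.inl hu)) u hu
    · exact hs _ (.inr rfl)
  | appR s t t' h =>
    simp only [Term.args, List.mem_append, List.mem_singleton] at hs ⊢
    rintro u (hu | rfl)
    · exact hs u (.inl hu)
    · exact (hC.computable _).2.1 _ (hs ⟨_, t⟩ (.inr rfl)) _ h

theorem acc_argStep {A : Ty Sg.S} (t : Term Sg A)
    (h : ∀ u ∈ t.args, Acc (fun x y => Step R y x) u.2) :
    Acc (fun x y => ArgStep R y x) t := by
  induction t with
  | fn f => exact ⟨_, fun _ h => by cases h⟩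
  | var x => exact ⟨_, fun _ h => by cases h⟩
  | app s t ih ih' =>
    simp only [Term.args, List.mem_append, List.mem_singleton] at h
    have hs := ih fun u hu => h u (.inl hu)
    have ht := h ⟨_, t⟩ (.inr rfl)
    clear h ih ih'
    dsimp only at ht
    induction hs generalizing t with
    | intro s _ ihs =>
      induction ht with
      | intro t ht iht =>
        refine ⟨_, fun u hu => ?_⟩
        cases hu with
        | appL _ s' _ h => exact ihs s' h t ⟨_, ht⟩
        | appR _ _ t' h => exact iht t' h

/-- A non-computable term whose arguments are computable has a non-computable reduct. Argument steps
cannot go on forever, as computable arguments terminate, and a calculation step would end in a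
computable value. -/
theorem IsComputabilitySet.exists_rootStep (hC : IsComputabilitySet R o C) {a : Sg.S}
    (s : Term Sg (Ty.base a)) (hs : ∀ u ∈ s.args, IsComputable C u.2) (hn : s ∉ C a) :
    ∃ s' t', Relation.ReflTransGen (ArgStep R) s s' ∧ (∀ u ∈ s'.args, IsComputable C u.2) ∧
      RootStep R s' t' ∧ t' ∉ C a := by
  have hacc := acc_argStep (R := R) s fun u hu => (hC.1.computable _).1 _ (hs u hu)
  induction hacc with
  | intro s _ ih =>
    have : ∃ t, Step R s t ∧ t ∉ C a := by
      by_contra! h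
      exact hn (hC.mem_of_step (fun u hu => hs u hu.mem_args) h)
    obtain ⟨t, hst, ht⟩ := this
    rcases hst.arg_or_root_or_calc with h | h | h
    · obtain ⟨s', t', h₁, h₂⟩ := ih t h (h.args_computable hC.1 hs) ht
      exact ⟨s', t', .head h h₁, h₂⟩
    · exact ⟨s, t, .refl, hs, h, ht⟩
    · exact (ht (hC.computable_of_isValue h.2.2.2.1)).elim

/-! ### Tuples of terms -/

/-- Tuples of terms of given types. -/
def TermTuple (Sg : Signature.{u, v, w, z}) : List (Ty Sg.S) → Type (max u v w)
  | [] => PUnit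
  | A :: L => Term Sg A × TermTuple Sg L

/-- The terms in a tuple. -/
def TermTuple.toList : {L : List (Ty Sg.S)} → TermTuple Sg L → List (Tm Sg)
  | [], _ => []
  | A :: _, us => ⟨A, us.1⟩ :: TermTuple.toList us.2

/-- The term `t u₁ ⋯ uₘ` of base type. -/
def Term.applyTerms :
    {A : Ty Sg.S} → Term Sg A → TermTuple Sg A.args → Term Sg (Ty.base A.target)
  | Ty.base _, t, _ => t
  | Ty.arr _ B, t, us => Term.applyTerms (A := B) (Term.app t us.1) us.2

/-- The instance of a tuple of variables. -/
def VarTuple.subst (σ : Subst Sg) : {L : List (Ty Sg.S)} → VarTuple Sg L → TermTuple Sg L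
  | [], _ => PUnit.unit
  | A :: _, xs => (σ A xs.1, VarTuple.subst σ xs.2)

theorem Term.subst_applyVars (σ : Subst Sg) {A : Ty Sg.S} (t : Term Sg A)
    (xs : VarTuple Sg A.args) :
    (t.applyVars xs).subst σ = (t.subst σ).applyTerms (xs.subst σ) := by
  induction A with
  | base a => rfl
  | arr A B _ ih => exact ih _ _

theorem Term.args_applyTerms {A : Ty Sg.S} (t : Term Sg A) (us : TermTuple Sg A.args) :
    (t.applyTerms us).args = t.args ++ us.toList := by
  induction A with
  | base a => exact (List.append_nil _).symm
  | arr A B _ ih =>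
    refine (ih (Term.app t us.1) us.2).trans ?_
    simp [Term.args, TermTuple.toList, Ty.args]

theorem Term.head_applyTerms {A : Ty Sg.S} (t : Term Sg A) (us : TermTuple Sg A.args) :
    (t.applyTerms us).head = t.head := by
  induction A with
  | base a => rfl
  | arr A B _ ih => exact ih (Term.app t us.1) us.2

theorem exists_applyTerms_notMem {A : Ty Sg.S} {t : Term Sg A} (ht : ¬ IsComputable C t) :
    ∃ us : TermTuple Sg A.args, (∀ u ∈ us.toList, IsComputable C u.2) ∧
      t.applyTerms us ∉ C A.target := by
  induction A with
  | base a => exact ⟨PUnit.unit, by simp [TermTuple.toList, Ty.args], ht⟩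
  | arr A B _ ih =>
    simp only [IsComputable, not_forall] at ht
    obtain ⟨s, hs, hts⟩ := ht
    obtain ⟨us, h₁, h₂⟩ := ih hts
    refine ⟨(s, us), ?_, h₂⟩
    rintro u (_ | ⟨_, hu⟩)
    · exact hs
    · exact h₁ u hu

/-- A failure would lead, by argument steps that keep the head, to a root step, which requires a
defined head. -/
theorem IsComputabilitySet.computable_fn (hC : IsComputabilitySet R o C) {A : Ty Sg.S}
    {f : Sg.F A} (hf : ¬ Defined R f) : IsComputable C (Term.fn f) := by
  by_contra h
  obtain ⟨us, h₁, h₂⟩ := exists_applyTerms_notMem h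
  obtain ⟨s', t', hs, -, hst, -⟩ := hC.exists_rootStep _
    (fun u hu => h₁ u (by simpa [Term.args_applyTerms, Term.args] using hu)) h₂
  have hhead : s'.head = ((Term.fn f).applyTerms us).head := by
    clear hst
    induction hs with
    | refl => rfl
    | tail _ h ih => rw [h.head_eq, ih]
  obtain ⟨g, hg, hdef⟩ := hst.head_defined
  rw [hhead, Term.head_applyTerms, Term.head, Sum.inl.injEq] at hg
  subst hg
  exact hf hdef

/-! ### Minimal non-computable instances -/

theorem IsComputabilitySet.computable_subst (hC : IsComputabilitySet R o C) {σ : Subst Sg}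
    {A : Ty Sg.S} {t : Term Sg A} (ht : ¬ DefHeaded R t)
    (hv : ∀ x ∈ t.vars, IsComputable C (σ x.1 x.2))
    (hp : ∀ u : Tm Sg, t.ProperSubterm u → IsComputable C (u.2.subst σ)) :
    IsComputable C (t.subst σ) := by
  induction t with
  | fn f => exact hC.computable_fn ht
  | var x => exact hv ⟨_, x⟩ rfl
  | app s t ih _ =>
    exact ih ht (fun x hx => hv x (.inl hx)) (fun u hu => hp u (.inr (.inr hu))) _
      (hp ⟨_, t⟩ (.inl rfl))

/-- `u` is a term with a defined head and computable proper subterms that is not computable, all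
under the substitution `σ`. -/
def IsMinimalNoncomputable (R : Set (Rule Sg)) (C : Family Sg) (σ : Subst Sg) (u : Tm Sg) : Prop :=
  DefHeaded R u.2 ∧ ¬ IsComputable C (u.2.subst σ) ∧
    ∀ v : Tm Sg, u.2.ProperSubterm v → IsComputable C (v.2.subst σ)

/-- Only proper subterms are considered because the prefix `s` of `app s t` is not a subterm: its
own failure could not be reported, while failures inside it can. -/
theorem IsComputabilitySet.exists_minimal_or (hC : IsComputabilitySet R o C) {σ : Subst Sg}
    {A : Ty Sg.S} (t : Term Sg A) (hv : ∀ x ∈ t.vars, IsComputable C (σ x.1 x.2)) :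
    (∃ u, t.ProperSubterm u ∧ IsMinimalNoncomputable R C σ u) ∨
      ∀ u : Tm Sg, t.ProperSubterm u → IsComputable C (u.2.subst σ) := by
  induction t with
  | fn f => exact .inr fun _ h => h.elim
  | var x => exact .inr fun _ h => h.elim
  | app s t ih₁ ih₂ =>
    rcases ih₁ fun x hx => hv x (.inl hx) with ⟨u, hu, hm⟩ | hs
    · exact .inl ⟨u, .inr (.inr hu), hm⟩
    have hvt : ∀ x ∈ t.vars, IsComputable C (σ x.1 x.2) := fun x hx => hv x (.inr hx)
    rcases ih₂ hvt with ⟨u, hu, hm⟩ | ht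
    · exact .inl ⟨u, .inr (.inl hu), hm⟩
    by_cases htc : IsComputable C (t.subst σ)
    · refine .inr ?_
      rintro u (rfl | hu | hu)
      · exact htc
      · exact ht u hu
      · exact hs u hu
    · exact .inl ⟨⟨_, t⟩, .inl rfl,
        not_not.1 fun hd => htc (hC.computable_subst hd hvt ht), htc, ht⟩

theorem IsComputabilitySet.exists_minimal (hC : IsComputabilitySet R o C) {σ : Subst Sg}
    {A : Ty Sg.S} {t : Term Sg A} (hv : ∀ x ∈ t.vars, IsComputable C (σ x.1 x.2))
    (ht : ¬ IsComputable C (t.subst σ)) :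
    ∃ u, t.Subterm u ∧ IsMinimalNoncomputable R C σ u := by
  rcases hC.exists_minimal_or t hv with ⟨u, hu, hm⟩ | h
  · exact ⟨u, .inr hu, hm⟩
  · exact ⟨⟨_, t⟩, .inl rfl, not_not.1 fun hd => ht (hC.computable_subst hd hv h), ht, h⟩

/-! ### Fresh variables -/

theorem exists_fresh_varTuple {W : Set (Var Sg)} (hW : W.Finite) (L : List (Ty Sg.S)) :
    ∃ xs : VarTuple Sg L, xs.toList.Nodup ∧ ∀ x ∈ xs.toList, x ∉ W := by
  induction L generalizing W with
  | nil => exact ⟨PUnit.unit, by simp [VarTuple.toList], by simp [VarTuple.toList]⟩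
  | cons A L ih =>
    have := Sg.infinite_vars A
    obtain ⟨x, hx⟩ := (hW.preimage (sigma_mk_injective (i := A)).injOn).exists_notMem
    obtain ⟨xs, h₁, h₂⟩ := ih (hW.insert ⟨A, x⟩)
    refine ⟨(x, xs), List.nodup_cons.2 ⟨fun h => h₂ _ h (.inl rfl), h₁⟩, ?_⟩
    rintro y (_ | ⟨_, hy⟩)
    · exact hx
    · exact fun h => h₂ y hy (.inr h)

theorem VarTuple.subst_congr {σ τ : Subst Sg} {L : List (Ty Sg.S)} (xs : VarTuple Sg L)
    (h : ∀ x ∈ xs.toList, σ x.1 x.2 = τ x.1 x.2) : xs.subst σ = xs.subst τ := by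
  induction L with
  | nil => rfl
  | cons A L ih =>
    simp only [VarTuple.subst]
    rw [ih xs.2 fun x hx => h x (List.mem_cons_of_mem _ hx)]
    rw [h ⟨A, xs.1⟩ (List.mem_cons_self ..)]

theorem VarTuple.mem_toList_subst (σ : Subst Sg) {L : List (Ty Sg.S)} {xs : VarTuple Sg L}
    {x : Var Sg} (h : x ∈ xs.toList) :
    (⟨x.1, σ x.1 x.2⟩ : Tm Sg) ∈ (xs.subst σ).toList := by
  induction L with
  | nil => simp [VarTuple.toList] at h
  | cons A L ih =>
    rcases List.mem_cons.1 h with rfl | h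
    · exact List.mem_cons_self ..
    · exact List.mem_cons_of_mem _ (ih h)

open Classical in
theorem exists_subst_varTuple (σ : Subst Sg) {L : List (Ty Sg.S)} {xs : VarTuple Sg L}
    (hxs : xs.toList.Nodup) (us : TermTuple Sg L) :
    ∃ τ : Subst Sg, xs.subst τ = us ∧ ∀ x ∉ xs.toList, τ x.1 x.2 = σ x.1 x.2 := by
  induction L with
  | nil => exact ⟨σ, rfl, fun _ _ => rfl⟩
  | cons A L ih =>
    obtain ⟨hx, hxs⟩ := List.nodup_cons.1 hxs
    obtain ⟨τ, h₁, h₂⟩ := ih hxs us.2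
    let τ' : Subst Sg := fun B y =>
      if h : (⟨A, xs.1⟩ : Var Sg) = ⟨B, y⟩ then cast (congrArg (fun v : Var Sg => Term Sg v.1) h) us.1 else τ B y
    have hτ' : ∀ y : Var Sg, ⟨A, xs.1⟩ ≠ y → τ' y.1 y.2 = τ y.1 y.2 := fun y hy => dif_neg hy
    refine ⟨τ', ?_, fun y hy => ?_⟩
    · have h₃ : VarTuple.subst τ' xs.2 = us.2 := by
        rw [← h₁]
        exact VarTuple.subst_congr _ fun y hy => hτ' y fun h => hx (h ▸ hy)
      exact Prod.ext (dif_pos rfl : τ' A xs.1 = us.1) h₃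
    · rw [hτ' y fun h => hy (h ▸ List.mem_cons_self ..)]
      exact h₂ y fun h => hy (List.mem_cons_of_mem _ h)

theorem Term.vars_applyVars {A : Ty Sg.S} (t : Term Sg A) (xs : VarTuple Sg A.args) {x : Var Sg}
    (h : x ∈ (t.applyVars xs).vars) : x ∈ t.vars ∨ x ∈ xs.toList := by
  induction A with
  | base a => exact .inl h
  | arr A B _ ih =>
    rcases ih (Term.app t (.var xs.1)) xs.2 h with (h | rfl) | h
    · exact .inl h
    · exact .inr (List.mem_cons_self ..)
    · exact .inr (List.mem_cons_of_mem _ h)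

theorem Term.properSubterm_applyVars {A : Ty Sg.S} (t : Term Sg A) (xs : VarTuple Sg A.args)
    {u : Tm Sg} (h : (t.applyVars xs).ProperSubterm u) :
    t.ProperSubterm u ∨ ∃ x ∈ xs.toList, u = ⟨x.1, .var x.2⟩ := by
  induction A with
  | base a => exact .inl h
  | arr A B _ ih =>
    rcases ih (Term.app t (.var xs.1)) xs.2 h with (rfl | h | h) | ⟨x, hx, rfl⟩
    · exact .inr ⟨⟨A, xs.1⟩, List.mem_cons_self .., rfl⟩
    · exact h.elim
    · exact .inl h
    · exact .inr ⟨x, List.mem_cons_of_mem _ hx, rfl⟩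

/-! ### Marked terms -/

theorem DefHeaded.subst {A : Ty Sg.S} {t : Term Sg A} (h : DefHeaded R t) (σ : Subst Sg) :
    DefHeaded R (t.subst σ) := by
  induction t with
  | fn f => exact h
  | var x => exact h.elim
  | app s t ih _ => exact ih h

theorem DefHeaded.applyVars {A : Ty Sg.S} {t : Term Sg A} (h : DefHeaded R t)
    (xs : VarTuple Sg A.args) : DefHeaded R (t.applyVars xs) := by
  induction A with
  | base a => exact h
  | arr A B _ ih => exact ih (t := Term.app t (.var xs.1)) h xs.2

theorem mark_subst {A : Ty Sg.S} {t : Term Sg A} (h : DefHeaded R t) (σ : Subst Sg) :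
    (mark R t h).subst σ = mark R (t.subst σ) (h.subst σ) := by
  induction t with
  | fn f => rfl
  | var x => exact h.elim
  | app s t ih _ => exact congrArg (fun m => Marked.app m (t.subst σ)) (ih h)

theorem mark_applyVars {A : Ty Sg.S} {t : Term Sg A} (h : DefHeaded R t)
    (xs : VarTuple Sg A.args) :
    (mark R t h).applyVars xs = mark R (t.applyVars xs) (h.applyVars xs) := by
  induction A with
  | base a => rfl
  | arr A B _ ih => exact ih (t := Term.app t (.var xs.1)) h xs.2

theorem properSubterm_mark {A : Ty Sg.S} {t : Term Sg A} (h : DefHeaded R t) {u : Tm Sg}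
    (hu : (mark R t h).ProperSubterm u) : t.ProperSubterm u := by
  induction t with
  | fn f => exact hu
  | var x => exact h.elim
  | app s t ih _ => exact hu.imp_right (Or.imp_right (ih h))

theorem ArgStep.defHeaded {A : Ty Sg.S} {s t : Term Sg A} (hst : ArgStep R s t)
    (h : DefHeaded R s) : DefHeaded R t := by
  induction hst with
  | appL s s' t _ ih => exact ih h
  | appR => exact h

theorem ArgStep.mark {A : Ty Sg.S} {s t : Term Sg A} (hst : ArgStep R s t)
    (h : DefHeaded R s) (h' : DefHeaded R t) :
    Marked.Step (LCSTRS.mark R s h) (LCSTRS.mark R t h') := by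
  induction hst with
  | appL s s' t _ ih => exact .appL _ _ _ (ih h h')
  | appR s t t' hst => exact .appR _ _ _ hst

/-- Marking blocks rewriting at the head, so exactly the argument steps carry over to marked terms.
-/
theorem reflTransGen_mark {A : Ty Sg.S} {s t : Term Sg A}
    (hst : Relation.ReflTransGen (ArgStep R) s t) (h : DefHeaded R s) :
    ∃ h' : DefHeaded R t, Relation.ReflTransGen Marked.Step (mark R s h) (mark R t h') := by
  induction hst with
  | refl => exact ⟨h, .refl⟩
  | tail _ hst ih =>
    obtain ⟨h', ih⟩ := ih
    exact ⟨hst.defHeaded h', ih.tail (hst.mark _ _)⟩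

theorem DefHeaded.exists_head {A : Ty Sg.S} {t : Term Sg A} (h : DefHeaded R t) :
    ∃ f : Sym Sg, t.head = Sum.inl f := by
  induction t with
  | fn f => exact ⟨_, rfl⟩
  | var x => exact h.elim
  | app s t ih _ => exact ih h

/-! ### Termination -/

/-- The tuple collects the arguments to the right of the contracted prefix. Both sides share it, and
the equalities are between typed pairs because the types agree only propositionally. -/
theorem RootStep.exists_applyTerms {A : Ty Sg.S} {s t : Term Sg A} (h : RootStep R s t)
    (us : TermTuple Sg A.args) :
    ∃ ρ ∈ R, ∃ σ : Subst Sg, ρ.Respects σ ∧ ∃ us' : TermTuple Sg ρ.ty.args,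
      (⟨_, s.applyTerms us⟩ : Tm Sg) = ⟨_, (ρ.lhs.subst σ).applyTerms us'⟩ ∧
      (⟨_, t.applyTerms us⟩ : Tm Sg) = ⟨_, (ρ.rhs.subst σ).applyTerms us'⟩ := by
  induction h with
  | rule ρ hρ σ hσ => exact ⟨ρ, hρ, σ, hσ, us, rfl, rfl⟩
  | app s s' t h ih => exact ih (t, us)

theorem Term.IsValue.isGroundTheory {A : Ty Sg.S} {v : Term Sg A} (h : v.IsValue) :
    v.IsGroundTheory := by
  cases v with
  | fn f => exact h.1
  | var x => exact h.elim
  | app s t => exact h.elim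

/-- Accessible function passing enters only here: logical variables become values, and every other
variable is an accessible subterm of a computable argument. -/
theorem computable_of_mem_rhs_vars (hR : AFPWith R o) (hC : IsComputabilitySet R o C)
    {ρ : Rule Sg} (hρ : ρ ∈ R) {σ : Subst Sg} (hσ : ρ.Respects σ)
    (hargs : ∀ u ∈ (ρ.lhs.subst σ).args, IsComputable C u.2) {x : Var Sg} (hx : x ∈ ρ.rhs.vars) :
    IsComputable C (σ x.1 x.2) := by
  by_cases hL : x ∈ ρ.logicVars
  · exact hC.computable_of_isValue (hσ.1 x hL)
  · have hx' : x ∈ (ρ.lhs.vars ∩ ρ.rhs.vars) \ ρ.constr.vars :=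
      ⟨⟨not_not.1 fun h => hL (.inr ⟨hx, h⟩), hx⟩, fun h => hL (.inl h)⟩
    obtain ⟨s, hs, hacc⟩ := hR ρ hρ x hx'
    obtain ⟨f, hf⟩ := ρ.lhs_head
    refine hC.accSubterm hacc (σ := σ) (hargs ⟨s.1, s.2.subst σ⟩ ?_)
    rw [ρ.lhs.args_subst σ hf]
    exact List.mem_map_of_mem hs

/-- Non-computable terms `f t₁ ⋯ tₙ` of base type, where `f` is defined and all `tᵢ` are
computable. -/
structure MinimalTerm (R : Set (Rule Sg)) (C : Family Sg) where
  sort : Sg.S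
  term : Term Sg (Ty.base sort)
  defHeaded : DefHeaded R term
  args_computable : ∀ u ∈ term.args, IsComputable C u.2
  notMem : term ∉ C sort

/-- A fresh instance of the non-computable term `u` below the substitution `σ`. -/
theorem IsMinimalNoncomputable.exists_minimalTerm {σ : Subst Sg} {u : Tm Sg}
    (hu : IsMinimalNoncomputable R C σ u) {W : Set (Var Sg)} (hW : W.Finite)
    (huW : u.2.vars ⊆ W) :
    ∃ (ys : VarTuple Sg u.1.args) (τ : Subst Sg) (m : MinimalTerm R C),
      ys.toList.Nodup ∧ (∀ y ∈ ys.toList, y ∉ W) ∧ (∀ x ∈ W, τ x.1 x.2 = σ x.1 x.2) ∧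
      ((mark R u.2 hu.1).applyVars ys).subst τ = mark R m.term m.defHeaded ∧
      ∀ v : Tm Sg, ((mark R u.2 hu.1).applyVars ys).ProperSubterm v →
        IsComputable C (v.2.subst τ) := by
  obtain ⟨hd, hn, hp⟩ := hu
  obtain ⟨ys, hnd, hys⟩ := exists_fresh_varTuple hW u.1.args
  obtain ⟨us, hus, hnus⟩ := exists_applyTerms_notMem hn
  obtain ⟨τ, hτ, hτσ⟩ := exists_subst_varTuple σ hnd us
  have hτW : ∀ x ∈ W, τ x.1 x.2 = σ x.1 x.2 := fun x hx => hτσ x fun h => hys x h hx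
  have hsub : u.2.subst τ = u.2.subst σ := u.2.subst_congr fun x hx => hτW x (huW hx)
  have hpτ : ∀ v : Tm Sg, u.2.ProperSubterm v → IsComputable C (v.2.subst τ) := fun v hv => by
    rw [v.2.subst_congr fun x hx => hτW x (huW (hv.vars_subset hx))]
    exact hp v hv
  obtain ⟨f, hf⟩ := hd.exists_head
  -- The variables `ys` are instantiated by computable arguments `us` witnessing that the instance
  -- of `u` is not computable.
  refine ⟨ys, τ, ⟨_, (u.2.applyVars ys).subst τ, (hd.applyVars ys).subst τ, ?_, ?_⟩,
    hnd, hys, hτW, ?_, ?_⟩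
  · rw [Term.subst_applyVars, hτ, Term.args_applyTerms, u.2.args_subst τ hf]
    intro v hv
    rcases List.mem_append.1 hv with hv | hv
    · obtain ⟨w, hw, rfl⟩ := List.mem_map.1 hv
      exact hpτ w (Term.properSubterm_of_mem_args hw)
    · exact hus v hv
  · rwa [Term.subst_applyVars, hτ, hsub]
  · rw [mark_applyVars]
    exact mark_subst _ _
  · intro v hv
    rw [mark_applyVars] at hv
    rcases Term.properSubterm_applyVars _ _ (properSubterm_mark _ hv) with hv | ⟨y, hy, rfl⟩
    · exact hpτ v hv
    · exact hus ⟨y.1, τ y.1 y.2⟩ (hτ ▸ VarTuple.mem_toList_subst τ hy)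

/-- One link of the chain. The instantiated target is again a marked minimal term, so the rewriting
to the next source comes from the next application. -/
theorem MinimalTerm.exists_next (hR : AFPWith R o) (hC : IsComputabilitySet R o C)
    (m : MinimalTerm R C) :
    ∃ d ∈ SDP R, ∃ σ : Subst Sg, d.Respects σ ∧
      Relation.ReflTransGen Marked.Step (mark R m.term m.defHeaded) (d.src.subst σ) ∧
      (∀ u : Tm Sg, d.tgt.ProperSubterm u → IsComputable C (u.2.subst σ)) ∧
      ∃ m' : MinimalTerm R C, d.tgt.subst σ = mark R m'.term m'.defHeaded := by
  obtain ⟨a, s, hd, hargs, hn⟩ := m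
  obtain ⟨s', t', hss', hargs', hroot, hn'⟩ := hC.exists_rootStep s hargs hn
  obtain ⟨hd', hmark⟩ := reflTransGen_mark hss' hd
  -- The terms have base type, so there are no further arguments to append.
  obtain ⟨ρ, hρ, σ, hσ, us, hs', ht'⟩ := hroot.exists_applyTerms PUnit.unit
  dsimp only
  change (⟨Ty.base a, s'⟩ : Tm Sg) = _ at hs'
  change (⟨Ty.base a, t'⟩ : Tm Sg) = _ at ht'
  cases hs'
  cases ht'
  rw [Term.args_applyTerms] at hargs'
  have hW₀ : (ρ.lhs.vars ∪ ρ.rhs.vars ∪ ρ.constr.vars).Finite :=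
    (ρ.lhs.finite_vars.union ρ.rhs.finite_vars).union ρ.constr.finite_vars
  -- These become the `xᵢ` of the dependency pair; `τ` sends them to the extra arguments `us` of the
  -- rule instance.
  obtain ⟨xs, hxs, hfresh⟩ := exists_fresh_varTuple hW₀ ρ.ty.args
  obtain ⟨τ, hτ, hτσ⟩ := exists_subst_varTuple σ hxs us
  have hτW : ∀ x ∈ ρ.lhs.vars ∪ ρ.rhs.vars ∪ ρ.constr.vars, τ x.1 x.2 = σ x.1 x.2 :=
    fun x hx => hτσ x fun h => hfresh x h hx
  have hv : ∀ x ∈ (ρ.rhs.applyVars xs).vars, IsComputable C (τ x.1 x.2) := by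
    intro x hx
    rcases ρ.rhs.vars_applyVars xs hx with hx | hx
    · rw [hτW x (.inl (.inr hx))]
      exact computable_of_mem_rhs_vars hR hC hρ hσ
        (fun u hu => hargs' u (List.mem_append_left _ hu)) hx
    · exact hargs' ⟨x.1, τ x.1 x.2⟩
        (List.mem_append_right _ (hτ ▸ VarTuple.mem_toList_subst τ hx))
  have hrhs : ¬ IsComputable C ((ρ.rhs.applyVars xs).subst τ) := by
    rw [Term.subst_applyVars, hτ, ρ.rhs.subst_congr fun x hx => hτW x (.inl (.inr hx))]
    exact hn'
  obtain ⟨u, hu, hmin⟩ := hC.exists_minimal hv hrhs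
  -- The `yⱼ` must avoid the `xᵢ` as well as the rule, so that one substitution `υ` serves both
  -- sides of the pair.
  set W : Set (Var Sg) := (ρ.lhs.vars ∪ ρ.rhs.vars ∪ ρ.constr.vars) ∪ {x | x ∈ xs.toList}
  have huW : u.2.vars ⊆ W := fun x hx =>
    (ρ.rhs.vars_applyVars xs (hu.vars_subset hx)).imp (fun h => .inl (.inr h)) id
  obtain ⟨ys, υ, m', hys, hysW, hυ, htgt, hcomp⟩ :=
    hmin.exists_minimalTerm (hW₀.union (List.finite_toSet _)) huW
  have hυσ : ∀ x ∈ ρ.lhs.vars ∪ ρ.rhs.vars ∪ ρ.constr.vars, υ x.1 x.2 = σ x.1 x.2 :=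
    fun x hx => (hυ x (.inl hx)).trans (hτW x hx)
  refine ⟨⟨(mark R ρ.lhs (defHeaded_lhs hρ)).applyVars xs, (mark R u.2 hmin.1).applyVars ys,
    ρ.constr, ρ.logicVars, ρ.constr_ok, Set.subset_union_left, ?_⟩,
    ⟨ρ, hρ, xs, u.1, u.2, hmin.1, ys, hu, ?_, ?_, rfl, rfl, rfl, rfl⟩, υ, ⟨?_, ?_⟩, ?_, hcomp,
    m', htgt⟩
  · rintro x (hx | hx)
    · exact ρ.constr_ok.2 x hx
    · exact ρ.rhs_vars x hx
  · exact List.nodup_append'.2 ⟨hxs, hys, fun x hx hy => hysW x hy (.inr hx)⟩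
  · intro x hx
    rcases List.mem_append.1 hx with hx | hx
    · exact hfresh x hx
    · exact fun h => hysW x hx (.inl h)
  · intro x hx
    rw [hυσ x (hx.elim .inr fun h => .inl (.inr h.1))]
    exact (hσ.1 x hx).isGroundTheory
  · dsimp only
    rw [ρ.constr.subst_congr fun x hx => hυσ x (.inr hx)]
    exact hσ.2
  · have hsrc : ((mark R ρ.lhs (defHeaded_lhs hρ)).applyVars xs).subst υ =
        mark R ((ρ.lhs.subst σ).applyTerms us) hd' := by
      rw [mark_applyVars]
      refine (mark_subst _ _).trans ?_
      congr 1
      rw [Term.subst_applyVars, VarTuple.subst_congr xs fun x hx => hυ x (.inr hx), hτ,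
        ρ.lhs.subst_congr fun x hx => hυσ x (.inl (.inl hx))]
    rw [hsrc]
    exact hmark

theorem MinimalTerm.exists_chain (hR : AFPWith R o) (hC : IsComputabilitySet R o C)
    (m : MinimalTerm R C) :
    ∃ (d : ℕ → DepPair R) (σ : ℕ → Subst Sg),
      IsInfiniteChain (SDP R) d σ ∧ IsComputableChain C d σ := by
  choose d hd σ hσ hsrc hcomp next hnext using
    fun m : MinimalTerm R C => m.exists_next hR hC
  refine ⟨fun i => d (next^[i] m), fun i => σ (next^[i] m),
    fun i => ⟨hd _, hσ _, ?_⟩, fun i => hcomp _⟩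
  simp only [Function.iterate_succ_apply']
  rw [hnext]
  exact hsrc _

/-- A non-computable symbol would be defined and, applied to suitable computable terms, would give a
minimal term. With all symbols and variables computable, so is every term, by closure under
application. -/
theorem terminating_of_isEmpty_minimalTerm (hC : IsComputabilitySet R o C)
    (h : IsEmpty (MinimalTerm R C)) : Terminating R := by
  have hfn : ∀ {A : Ty Sg.S} (f : Sg.F A), IsComputable C (Term.fn f) := by
    intro A f
    by_contra hf
    obtain ⟨us, h₁, h₂⟩ := exists_applyTerms_notMem hf
    have hdef : Defined R f := not_not.1 fun h => hf (hC.computable_fn h)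
    exact h.false ⟨_, _, defHeaded_of_head R _ ⟨A, f⟩ (Term.head_applyTerms _ us) hdef,
      fun u hu => h₁ u (by simpa [Term.args_applyTerms, Term.args] using hu), h₂⟩
  intro A t
  rw [terminatingFrom_iff_acc]
  refine (hC.1.computable A).1 t ?_
  induction t with
  | fn f => exact hfn f
  | var x => exact hC.1.computable_var x
  | app s t ih₁ ih₂ => exact ih₁ t ih₂

end LCSTRS

theorem mainTheorem1 (Sg : Signature.{u, v, w, z}) (R : Set (Rule Sg))
    (o : SortOrdering Sg.S) (hR : AFPWith R o) :
    (∃ C : Family Sg, IsComputabilitySet R o C) ∧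
    ∀ C : Family Sg, IsComputabilitySet R o C →
      (¬ ∃ (d : ℕ → DepPair R) (σ : ℕ → Subst Sg),
        IsInfiniteChain (SDP R) d σ ∧ IsComputableChain C d σ) →
      Terminating R :=
  ⟨⟨_, isComputabilitySet_computabilityFamily R o⟩, fun _ hC h =>
    terminating_of_isEmpty_minimalTerm hC ⟨fun m => h (m.exists_chain hR hC)⟩⟩
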